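/- Let $P, I_1, O_1, \dots, I_n, O_n, F$ be quantum systems with nonzero finite-dimensional Hilbert spaces ($n\ge 0$). An $n$-slot supermap is represented by a linear map $\mathcal C$ from operators on $PO_1\cdots O_n$ to operators on $I_1\cdots I_nF$, with Choi operator $\mathsf C=\sum_{i,j}|i\rangle\langle j|\otimes\mathcal C(|i\rangle\langle j|)$ on $PI_1O_1\cdots I_nO_nF$. It is an $n$-slot quantum comb if it is completely positive and there are operators $\mathsf C^{(k)}$ on $PI_1O_1\cdots O_{k-1}I_k$ ($1\le k\le n$) such that, with $\mathsf C^{(n+1)}=\mathsf C$ and $I_{n+1}=F$, $$\operatorname{tr}_{I_{k+1}}\mathsf C^{(k+1)}=\mathsf C^{(k)}\otimes\mathbb 1_{O_k}\quad(1\le k\le n),\qquad \operatorname{tr}_{I_1}\mathsf C^{(1)}=\mathbb 1_P .$$ An $n$-slot virtual comb is a finite sum $\widetilde{\mathcal C}=\sum_i\alpha_i\mathcal C_i$ with $\alpha_i\in\mathbb R$, $\sum_i\alpha_i=1$ and every $\mathcal C_i$ an $n$-slot quantum comb. Its base norm is $$\|\widetilde{\mathcal C}\|_{\mathrm{base}}=\min\{\alpha_++\alpha_-:\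 \alpha_\pm\ge 0,\ \widetilde{\mathcal C}=\alpha_+\mathcal C_+-\alpha_-\mathcal C_-,\ \mathcal C_\pm\ \text{$n$-slot quantum combs}\},$$ and its diamond norm is $$\|\widetilde{\mathcal C}\|_{\diamond}=\max_{\Xi^{(n)}}\Big\|\big(\mathbb 1_F\otimes\sqrt{\Xi^{(n)}}\big)\,\widetilde{\mathsf C}\,\big(\mathbb 1_F\otimes\sqrt{\Xi^{(n)}}\big)\Big\|_1 ,$$ where $\widetilde{\mathsf C}$ is the Choi operator of $\widetilde{\mathcal C}$, $\|X\|_1=\operatorname{tr}\sqrt{X^\dagger X}$, and $\Xi^{(n)}$ ranges over the operators on $PI_1O_1\cdots I_nO_n$ for which there are an $n$-slot quantum tester $\{\mathsf T_i\}_i$ and operators $\Xi^{(k)}$ on $PI_1O_1\cdots I_kO_k$ ($0\le k<n$) with $\mathsf T_i\ge 0$ and $$\sum_i\mathsf T_i=\mathbb 1_F\otimes\Xi^{(n)},\qquad \operatorname{tr}_{O_k}\Xi^{(k)}=\mathbb 1_{I_k}\otimes\Xi^{(k-1)}\ (1\le k\le n),\qquad \operatorname{tr}\Xi^{(0)}=1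 .$$ Then, for every $n$-slot virtual comb $\widetilde{\mathcal C}$, the minimum and the maximum are attained, and $\|\widetilde{\mathcal C}\|_{\mathrm{base}}=\|\widetilde{\mathcal C}\|_{\diamond}$. -/

import Mathlib

open scoped Kronecker ComplexOrder MatrixOrder Matrix

universe u

namespace QComb

/-! ### Systems

A quantum system is given by a finite type indexing its computational basis; operators on it
are complex matrices. The systems of an `n`-slot comb, in causal order, are
`P, I₀, O₀, I₁, O₁, …, Iₙ₋₁, Oₙ₋₁, F`: the comb receives `P`, feeds `Iₖ` into the `k`-th slot,
gets back `Oₖ`, and finally outputs `F`. -/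

/-- Basis of `P I₀ O₀ ⋯ Iₙ₋₁ Oₙ₋₁`. -/
def Sys (P : Type u) (I O : ℕ → Type u) : ℕ → Type u
  | 0 => P
  | n + 1 => (Sys P I O n × I n) × O n

/-- Basis of `P O₀ ⋯ Oₙ₋₁`, everything that an `n`-slot comb receives. -/
def InSys (P : Type u) (O : ℕ → Type u) : ℕ → Type u
  | 0 => P
  | n + 1 => InSys P O n × O n

/-- Basis of `I₀ ⋯ Iₙ₋₁`, everything that an `n`-slot comb emits before `F`. -/
def OutSys (I : ℕ → Type u) : ℕ → Type u
  | 0 => PUnit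
  | n + 1 => OutSys I n × I n

section instances

variable (P : Type u) (I O : ℕ → Type u)

instance instFintypeSys [Fintype P] [∀ k, Fintype (I k)] [∀ k, Fintype (O k)] :
    (n : ℕ) → Fintype (Sys P I O n)
  | 0 => inferInstanceAs (Fintype P)
  | n + 1 =>
    haveI := instFintypeSys n
    inferInstanceAs (Fintype ((Sys P I O n × I n) × O n))

instance instDecidableEqSys [DecidableEq P] [∀ k, DecidableEq (I k)] [∀ k, DecidableEq (O k)] :
    (n : ℕ) → DecidableEq (Sys P I O n)
  | 0 => inferInstanceAs (DecidableEq P)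
  | n + 1 =>
    haveI := instDecidableEqSys n
    inferInstanceAs (DecidableEq ((Sys P I O n × I n) × O n))

instance instDecidableEqInSys [DecidableEq P] [∀ k, DecidableEq (O k)] :
    (n : ℕ) → DecidableEq (InSys P O n)
  | 0 => inferInstanceAs (DecidableEq P)
  | n + 1 =>
    haveI := instDecidableEqInSys n
    inferInstanceAs (DecidableEq (InSys P O n × O n))

end instances

/-- The `P O₀ ⋯ Oₙ₋₁` part of a basis index. -/
def Sys.toIn {P : Type u} {I O : ℕ → Type u} : (n : ℕ) → Sys P I O n → InSys P O n
  | 0, p => p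
  | n + 1, x => (Sys.toIn n x.1.1, x.2)

/-- The `I₀ ⋯ Iₙ₋₁` part of a basis index. -/
def Sys.toOut {P : Type u} {I O : ℕ → Type u} : (n : ℕ) → Sys P I O n → OutSys I n
  | 0, _ => PUnit.unit
  | n + 1, x => (Sys.toOut n x.1.1, x.1.2)

/-! ### Matrix notions -/

/-- Partial trace over the second tensor factor. -/
def traceRight {a b : Type u} [Fintype b] (X : Matrix (a × b) (a × b) ℂ) : Matrix a a ℂ :=
  Matrix.of fun i j => ∑ k, X (i, k) (j, k)

/-- The trace norm `‖X‖₁ = tr √(X† X)`. -/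
noncomputable def traceNorm {a : Type u} [Fintype a] [DecidableEq a] (X : Matrix a a ℂ) : ℝ :=
  (CFC.sqrt (Xᴴ * X)).trace.re

/-- Complete positivity: `id_R ⊗ Φ` preserves positive semidefiniteness for every finite
dimensional ancilla `R`. -/
def IsCP {a b : Type u} (Φ : Matrix a a ℂ →ₗ[ℂ] Matrix b b ℂ) : Prop :=
  ∀ (r : ℕ) (X : Matrix (Fin r × a) (Fin r × a) ℂ), X.PosSemidef →
    (Matrix.of fun x y : Fin r × b =>
      Φ (Matrix.of fun i j => X (x.1, i) (y.1, j)) x.2 y.2).PosSemidef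

/-! ### Combs -/

/-- An `n`-slot linear supermap, as the linear map from operators on `P O₀ ⋯ Oₙ₋₁` to operators
on `I₀ ⋯ Iₙ₋₁ F` that represents it. -/
abbrev Supermap (P F : Type u) (I O : ℕ → Type u) (n : ℕ) : Type u :=
  Matrix (InSys P O n) (InSys P O n) ℂ →ₗ[ℂ] Matrix (OutSys I n × F) (OutSys I n × F) ℂ

section combs

variable {P F : Type u} {I O : ℕ → Type u}

/-- The Choi operator `∑ᵢⱼ |i⟩⟨j| ⊗ 𝒞(|i⟩⟨j|)`, with the tensor factors listed in causal order. -/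
def choi [DecidableEq P] [∀ k, DecidableEq (O k)] (n : ℕ) (C : Supermap P F I O n) :
    Matrix (Sys P I O n × F) (Sys P I O n × F) ℂ :=
  Matrix.of fun x y =>
    C (Matrix.single (Sys.toIn n x.1) (Sys.toIn n y.1) 1)
      (Sys.toOut n x.1, x.2) (Sys.toOut n y.1, y.2)

/-- The causal normalization conditions, for an operator `D` on `P I₀ O₀ ⋯ Iₙ₋₁ Oₙ₋₁`:
`D = E ⊗ 1` on `Oₙ₋₁`, and the partial trace of `E` over `Iₙ₋₁` satisfies the conditions with
one slot less, down to the identity on `P`. -/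
def IsCombMarginal [DecidableEq P] [∀ k, Fintype (I k)] [∀ k, DecidableEq (O k)] :
    (n : ℕ) → Matrix (Sys P I O n) (Sys P I O n) ℂ → Prop
  | 0, D => D = (1 : Matrix P P ℂ)
  | n + 1, D => ∃ E : Matrix (Sys P I O n × I n) (Sys P I O n × I n) ℂ,
      D = E ⊗ₖ (1 : Matrix (O n) (O n) ℂ) ∧ IsCombMarginal n (traceRight E)

/-- `n`-slot quantum combs: completely positive, and the Choi operator traced over `F` satisfies
the causal normalization conditions (which include trace preservation). -/
structure IsComb [Fintype F] [DecidableEq P] [∀ k, Fintype (I k)] [∀ k, DecidableEq (O k)]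
    (n : ℕ) (C : Supermap P F I O n) : Prop where
  cp : IsCP C
  marginal : IsCombMarginal n (traceRight (choi n C))

/-- `n`-slot virtual combs: finite real affine combinations of `n`-slot quantum combs. -/
def IsVirtualComb [Fintype F] [DecidableEq P] [∀ k, Fintype (I k)] [∀ k, DecidableEq (O k)]
    (n : ℕ) (C : Supermap P F I O n) : Prop :=
  ∃ (m : ℕ) (α : Fin m → ℝ) (D : Fin m → Supermap P F I O n),
    (∀ i, IsComb n (D i)) ∧ ∑ i, α i = 1 ∧ C = ∑ i, (α i : ℂ) • D i

/-- The values `α₊ + α₋` over all decompositions `𝒞 = α₊ 𝒞₊ - α₋ 𝒞₋` with `α₊, α₋ ≥ 0` and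
`𝒞₊, 𝒞₋` quantum combs. -/
def baseNormValues [Fintype F] [DecidableEq P] [∀ k, Fintype (I k)] [∀ k, DecidableEq (O k)]
    (n : ℕ) (C : Supermap P F I O n) : Set ℝ :=
  {v | ∃ (αp αm : ℝ) (Cp Cm : Supermap P F I O n), 0 ≤ αp ∧ 0 ≤ αm ∧
    IsComb n Cp ∧ IsComb n Cm ∧ C = (αp : ℂ) • Cp - (αm : ℂ) • Cm ∧ v = αp + αm}

/-- The base norm with respect to the set of quantum combs. -/
noncomputable def baseNorm [Fintype F] [DecidableEq P] [∀ k, Fintype (I k)]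
    [∀ k, DecidableEq (O k)] (n : ℕ) (C : Supermap P F I O n) : ℝ :=
  sInf (baseNormValues n C)

/-- The normalization of testers, for an operator `Ξ` on `P I₀ O₀ ⋯ Iₙ₋₁ Oₙ₋₁`: the partial trace
over `Oₙ₋₁` is `Ξ' ⊗ 1` on `Iₙ₋₁`, where `Ξ'` satisfies the conditions with one slot less, down
to an operator of trace one on `P`. -/
def IsTesterMarginal [Fintype P] [∀ k, DecidableEq (I k)] [∀ k, Fintype (O k)] :
    (n : ℕ) → Matrix (Sys P I O n) (Sys P I O n) ℂ → Prop
  | 0, Ξ => Matrix.trace (n := P) Ξ = 1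
  | n + 1, Ξ => ∃ Ξ' : Matrix (Sys P I O n) (Sys P I O n) ℂ,
      traceRight (a := Sys P I O n × I n) (b := O n) Ξ = Ξ' ⊗ₖ (1 : Matrix (I n) (I n) ℂ) ∧
        IsTesterMarginal n Ξ'

/-- `{T i}` is an `n`-slot quantum tester with `∑ i, T i = Ξ ⊗ 1` on `F`. -/
structure IsTester [Fintype P] [DecidableEq F] [∀ k, DecidableEq (I k)] [∀ k, Fintype (O k)]
    (n : ℕ) {m : ℕ} (T : Fin m → Matrix (Sys P I O n × F) (Sys P I O n × F) ℂ)
    (Ξ : Matrix (Sys P I O n) (Sys P I O n) ℂ) : Prop where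
  posSemidef : ∀ i, (T i).PosSemidef
  sum_eq : ∑ i, T i = Ξ ⊗ₖ (1 : Matrix F F ℂ)
  marginal : IsTesterMarginal n Ξ

/-- The values `‖(1 ⊗ √Ξ) 𝖢 (1 ⊗ √Ξ)‖₁`, with `𝖢` the Choi operator of `𝒞`, over all `n`-slot
quantum testers. -/
def diamondNormValues [Fintype P] [DecidableEq P] [Fintype F] [DecidableEq F]
    [∀ k, Fintype (I k)] [∀ k, DecidableEq (I k)] [∀ k, Fintype (O k)] [∀ k, DecidableEq (O k)]
    (n : ℕ) (C : Supermap P F I O n) : Set ℝ :=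
  {v | ∃ (m : ℕ) (T : Fin m → Matrix (Sys P I O n × F) (Sys P I O n × F) ℂ)
    (Ξ : Matrix (Sys P I O n) (Sys P I O n) ℂ), IsTester n T Ξ ∧
      v = traceNorm ((CFC.sqrt Ξ ⊗ₖ (1 : Matrix F F ℂ)) * choi n C *
        (CFC.sqrt Ξ ⊗ₖ (1 : Matrix F F ℂ)))}

/-- The diamond norm of a supermap. -/
noncomputable def diamondNorm [Fintype P] [DecidableEq P] [Fintype F] [DecidableEq F]
    [∀ k, Fintype (I k)] [∀ k, DecidableEq (I k)] [∀ k, Fintype (O k)] [∀ k, DecidableEq (O k)]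
    (n : ℕ) (C : Supermap P F I O n) : ℝ :=
  sSup (diamondNormValues n C)

end combs

end QComb

/-!
Everything is expressed through Choi operators: `choi` is a linear bijection, and by Choi's theorem
complete positivity of a supermap is positivity of its Choi operator (`isComb_iff`). Hence combs are
the positive operators in an affine space, and the base norm is the optimal value of a conic
program: minimize `r + s` over decompositions `𝖢 = X - Y` into positive operators satisfying the
causal conditions with scales `r` and `s` (`mem_baseNormValues_iff`). Since `r + s` is determined by
`tr X`, and positive operators of bounded trace form a compact set, the minimum `β` is attained
(`exists_isLeast_baseNormValues`).

The inequality `diamond ≤ base` is the triangle inequality: if `Ξ` is the normalization of a tester,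
conjugating a comb with `√Ξ ⊗ 1` gives a positive operator of trace one (`diamond_le_base`).

For the converse, a tester `T₁ + T₂ = Ξ ⊗ 1` with `tr 𝖢 (T₁ - T₂) = β` is produced by M. Riesz's
extension theorem (`exists_tester_pair`): a functional on a subspace of pairs of operators,
nonnegative there because `β` is minimal, extends to a positive functional on all pairs, which is a
pair `T₁, T₂` of positive operators. The subspace contains `(1, 1)`, so the extension theorem
applies. The prescribed values on combs say that `T₁ + T₂` pairs to one with every element of the
affine span of combs, and these operators are exactly the `Ξ ⊗ 1` with `Ξ` normalized as a tester
(`exists_isTesterMarginal_of_trace_mul`, by peeling off one slot at a time). Finally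
`-Ξ ⊗ 1 ≤ T₁ - T₂ ≤ Ξ ⊗ 1` gives
`β = tr 𝖢 (T₁ - T₂) ≤ ‖(√Ξ ⊗ 1) 𝖢 (√Ξ ⊗ 1)‖₁` (`re_trace_mul_le_traceNorm_conj`), so this tester
attains the maximum.
-/

namespace QComb

/-! ### The trace norm of Hermitian matrices -/

section traceNorm

variable {a : Type u} [Fintype a] [DecidableEq a]

lemma re_trace_mul_nonneg {A B : Matrix a a ℂ} (hA : A.PosSemidef) (hB : B.PosSemidef) :
    0 ≤ (A * B).trace.re := by
  obtain ⟨D, rfl⟩ := CStarAlgebra.nonneg_iff_eq_star_mul_self.mp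
    (Matrix.nonneg_iff_posSemidef.mpr hB)
  rw [← mul_assoc, Matrix.trace_mul_comm, ← mul_assoc, Matrix.star_eq_conjTranspose]
  exact (Complex.le_def.mp (hA.mul_mul_conjTranspose_same D).trace_nonneg).1

lemma traceNorm_eq_posPart_add_negPart {X : Matrix a a ℂ} (hX : X.IsHermitian) :
    traceNorm X = (X⁺).trace.re + (X⁻).trace.re := by
  have h := CFC.posPart_add_negPart X hX
  rw [← Complex.add_re, ← Matrix.trace_add, h]
  rfl

lemma re_trace_mul_le_traceNorm {X M : Matrix a a ℂ} (hX : X.IsHermitian)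
    (h₁ : (1 - M).PosSemidef) (h₂ : (1 + M).PosSemidef) :
    (X * M).trace.re ≤ traceNorm X := by
  have hp : (X⁺).PosSemidef := Matrix.nonneg_iff_posSemidef.mp (CFC.posPart_nonneg X)
  have hm : (X⁻).PosSemidef := Matrix.nonneg_iff_posSemidef.mp (CFC.negPart_nonneg X)
  have e : X * M = X⁺ * M - X⁻ * M := by
    rw [← sub_mul, CFC.posPart_sub_negPart X hX]
  have e₁ := re_trace_mul_nonneg hp h₁
  have e₂ := re_trace_mul_nonneg hm h₂
  rw [traceNorm_eq_posPart_add_negPart hX, e]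
  simp only [mul_sub, mul_add, mul_one, Matrix.trace_sub, Matrix.trace_add, Complex.sub_re,
    Complex.add_re] at e₁ e₂ ⊢
  linarith

/-- The sign of a Hermitian matrix is a contraction attaining the trace norm. -/
lemma exists_trace_mul_eq_traceNorm {X : Matrix a a ℂ} (hX : X.IsHermitian) :
    ∃ S : Matrix a a ℂ, (1 - S).PosSemidef ∧ (1 + S).PosSemidef ∧
      (X * S).trace.re = traceNorm X := by
  have hX' : IsSelfAdjoint X := hX
  have hc : ∀ f : ℝ → ℝ, ContinuousOn f (spectrum ℝ X) := fun f =>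
    (Matrix.finite_real_spectrum (A := X)).continuousOn f
  let s : ℝ → ℝ := fun x => if 0 ≤ x then 1 else -1
  refine ⟨cfc s X, ?_, ?_, ?_⟩
  · rw [← Matrix.nonneg_iff_posSemidef, ← cfc_one ℝ X, ← cfc_sub _ _ X (hc _) (hc _)]
    refine cfc_nonneg fun x _ => ?_
    simp only [s, Pi.one_apply]
    split_ifs <;> norm_num
  · rw [← Matrix.nonneg_iff_posSemidef, ← cfc_one ℝ X, ← cfc_add X _ _ (hc _) (hc _)]
    refine cfc_nonneg fun x _ => ?_
    simp only [s, Pi.one_apply]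
    split_ifs <;> norm_num
  · have h : X * cfc s X = CFC.abs X := by
      rw [CFC.abs_eq_cfc_norm X hX']
      nth_rewrite 1 [← cfc_id ℝ X]
      rw [← cfc_mul _ _ X (hc _) (hc _)]
      refine cfc_congr fun x _ => ?_
      simp only [s, id, Real.norm_eq_abs]
      split_ifs with h
      · rw [abs_of_nonneg h, mul_one]
      · rw [abs_of_neg (not_le.mp h)]; ring
    rw [h]
    rfl

lemma traceNorm_sub_le {Y Z : Matrix a a ℂ} (hY : Y.PosSemidef) (hZ : Z.PosSemidef) :
    traceNorm (Y - Z) ≤ Y.trace.re + Z.trace.re := by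
  obtain ⟨S, h₁, h₂, h⟩ := exists_trace_mul_eq_traceNorm (hY.1.sub hZ.1)
  have e₁ := re_trace_mul_nonneg hY h₁
  have e₂ := re_trace_mul_nonneg hZ h₂
  rw [← h]
  simp only [mul_sub, mul_add, sub_mul, mul_one, Matrix.trace_sub, Matrix.trace_add,
    Complex.sub_re, Complex.add_re] at e₁ e₂ ⊢
  linarith

/-- If `-R² ≤ T ≤ R²` then `tr (C T) ≤ ‖R C R‖₁`. For invertible `R` this is
`re_trace_mul_le_traceNorm` applied to the contraction `R⁻¹ T R⁻¹`; in general `R` is replaced by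
`R + ε`. -/
lemma re_trace_mul_le_traceNorm_conj {R C T : Matrix a a ℂ} (hR : R.PosSemidef)
    (hC : C.IsHermitian) (h₁ : (R * R - T).PosSemidef) (h₂ : (R * R + T).PosSemidef) :
    (C * T).trace.re ≤ traceNorm (R * C * R) := by
  set K := C * R + R * C with hK
  have hRh : Rᴴ = R := hR.1
  have hCh : Cᴴ = C := hC
  have key : ∀ ε : ℝ, 0 < ε → (C * T).trace.re ≤
      traceNorm (R * C * R) + ε * traceNorm K + ε ^ 2 * traceNorm C := by
    intro ε hε
    set Q : Matrix a a ℂ := R + (ε : ℂ) • 1 with hQ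
    have hεc : (0 : ℂ) < (ε : ℂ) := by exact_mod_cast hε
    have hQp : Q.PosDef := Matrix.PosDef.posSemidef_add hR (Matrix.PosDef.one.smul hεc)
    have hu : IsUnit Q.det := (Matrix.isUnit_iff_isUnit_det Q).mp hQp.isUnit
    have hQi : (Q⁻¹)ᴴ = Q⁻¹ := hQp.inv.1
    have hQQ : (Q * Q - R * R).PosSemidef := by
      have : Q * Q - R * R = ((2 * ε : ℝ) : ℂ) • R + ((ε ^ 2 : ℝ) : ℂ) • 1 := by
        rw [hQ]
        simp only [mul_add, add_mul, Matrix.mul_smul, Matrix.smul_mul, mul_one, one_mul, smul_smul]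
        push_cast
        module
      rw [this]
      refine (hR.smul ?_).add (Matrix.PosSemidef.one.smul ?_) <;>
      · rw [Complex.zero_le_real]; positivity
    set M := Q⁻¹ * T * Q⁻¹ with hM
    have hone : Q⁻¹ * (Q * Q) * Q⁻¹ = 1 := by
      rw [← mul_assoc, Matrix.nonsing_inv_mul _ hu, one_mul, Matrix.mul_nonsing_inv _ hu]
    have hM₁ : (1 - M).PosSemidef := by
      have := (hQQ.add h₁).conjTranspose_mul_mul_same Q⁻¹
      rw [hQi] at this
      convert this using 1
      rw [sub_add_sub_cancel, mul_sub, sub_mul, hone]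
    have hM₂ : (1 + M).PosSemidef := by
      have := (hQQ.add h₂).conjTranspose_mul_mul_same Q⁻¹
      rw [hQi] at this
      convert this using 1
      rw [← add_assoc, sub_add_cancel, mul_add, add_mul, hone]
    have hT : T = Q * M * Q := by
      rw [hM, mul_assoc, mul_assoc, mul_assoc, Matrix.nonsing_inv_mul _ hu, mul_one, ← mul_assoc,
        Matrix.mul_nonsing_inv _ hu, one_mul]
    have hdec : Q * C * Q = R * C * R + (ε : ℂ) • K + ((ε : ℂ) ^ 2) • C := by
      rw [hQ, hK]
      simp only [mul_add, add_mul, Matrix.mul_smul, Matrix.smul_mul, mul_one, one_mul, smul_smul,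
        smul_add]
      module
    have htr : (C * T).trace = (R * C * R * M).trace + (ε : ℂ) * (K * M).trace
        + (ε : ℂ) ^ 2 * (C * M).trace := by
      have : (C * T).trace = (Q * C * Q * M).trace := by
        rw [hT, ← mul_assoc, Matrix.trace_mul_comm]
        simp only [mul_assoc]
      rw [this, hdec]
      simp only [add_mul, Matrix.smul_mul, Matrix.trace_add, Matrix.trace_smul, smul_eq_mul]
    have hRCR : (R * C * R).IsHermitian := by
      simp only [Matrix.IsHermitian, Matrix.conjTranspose_mul, hRh, hCh, mul_assoc]
    have hKh : K.IsHermitian := by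
      rw [hK, Matrix.IsHermitian, Matrix.conjTranspose_add, Matrix.conjTranspose_mul,
        Matrix.conjTranspose_mul, hRh, hCh, add_comm]
    have a₁ := re_trace_mul_le_traceNorm hRCR hM₁ hM₂
    have a₂ := mul_le_mul_of_nonneg_left (re_trace_mul_le_traceNorm hKh hM₁ hM₂) hε.le
    have a₃ := mul_le_mul_of_nonneg_left (re_trace_mul_le_traceNorm hC hM₁ hM₂) (sq_nonneg ε)
    rw [htr, ← Complex.ofReal_pow, Complex.add_re, Complex.add_re, Complex.re_ofReal_mul,
      Complex.re_ofReal_mul]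
    linarith
  have hlim : Filter.Tendsto (fun ε : ℝ => traceNorm (R * C * R) + ε * traceNorm K
      + ε ^ 2 * traceNorm C) (nhdsWithin 0 (Set.Ioi 0)) (nhds (traceNorm (R * C * R))) := by
    have : Continuous fun ε : ℝ => traceNorm (R * C * R) + ε * traceNorm K
      + ε ^ 2 * traceNorm C := by fun_prop
    have h := this.tendsto 0
    simp only [zero_mul, add_zero, ne_eq, OfNat.ofNat_ne_zero, not_false_eq_true, zero_pow] at h
    exact h.mono_left nhdsWithin_le_nhds
  refine ge_of_tendsto hlim ?_
  filter_upwards [self_mem_nhdsWithin] with ε hε using key ε hε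

end traceNorm

/-! ### Partial traces -/

section traceRight

variable {a b : Type u} [Fintype b]

lemma traceRight_add (X Y : Matrix (a × b) (a × b) ℂ) :
    traceRight (X + Y) = traceRight X + traceRight Y := by
  ext i j
  simp [traceRight, Finset.sum_add_distrib]

lemma traceRight_smul (c : ℂ) (X : Matrix (a × b) (a × b) ℂ) :
    traceRight (c • X) = c • traceRight X := by
  ext i j
  simp [traceRight, Finset.mul_sum]

lemma traceRight_conjTranspose (X : Matrix (a × b) (a × b) ℂ) :
    traceRight Xᴴ = (traceRight X)ᴴ := by
  ext i j
  simp [traceRight]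

lemma traceRight_kronecker (M : Matrix a a ℂ) (N : Matrix b b ℂ) :
    traceRight (M ⊗ₖ N) = N.trace • M := by
  ext i j
  simp [traceRight, Matrix.trace, ← Finset.mul_sum, mul_comm]

lemma trace_traceRight [Fintype a] (X : Matrix (a × b) (a × b) ℂ) :
    (traceRight X).trace = X.trace := by
  simp [traceRight, Matrix.trace, Fintype.sum_prod_type]

lemma trace_kronecker_one_mul [Fintype a] [DecidableEq b] (M : Matrix a a ℂ)
    (X : Matrix (a × b) (a × b) ℂ) :
    ((M ⊗ₖ (1 : Matrix b b ℂ)) * X).trace = (M * traceRight X).trace := by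
  simp only [Matrix.trace, Matrix.diag, Matrix.mul_apply, Fintype.sum_prod_type, traceRight,
    Matrix.kronecker_apply, Matrix.one_apply, Matrix.of_apply, mul_ite, mul_one, mul_zero, ite_mul,
    zero_mul, Finset.sum_ite_eq, Finset.mem_univ, if_true, Finset.mul_sum]
  exact Finset.sum_congr rfl fun _ _ => Finset.sum_comm

/-- An operator that is orthogonal to all operators of vanishing partial trace is of the form
`Ξ ⊗ 1`. -/
lemma exists_eq_kronecker_one [Fintype a] [DecidableEq a] [DecidableEq b] [Nonempty b]
    (T : Matrix (a × b) (a × b) ℂ) (h : ∀ D, traceRight D = 0 → (T * D).trace = 0) :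
    ∃ Ξ : Matrix a a ℂ, T = Ξ ⊗ₖ (1 : Matrix b b ℂ) := by
  obtain ⟨f₀⟩ := ‹Nonempty b›
  refine ⟨Matrix.of fun i j => T (i, f₀) (j, f₀), ?_⟩
  have htr : ∀ (x y : a × b), (T * Matrix.single x y 1).trace = T y x := by
    intro x y
    simp [Matrix.trace_mul_single]
  ext ⟨i, f⟩ ⟨j, g⟩
  simp only [Matrix.kronecker_apply, Matrix.of_apply, Matrix.one_apply, mul_ite, mul_one, mul_zero]
  split_ifs with hfg
  · subst hfg
    have := h (Matrix.single (j, f) (i, f) 1 - Matrix.single (j, f₀) (i, f₀) 1) (by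
      ext x y
      simp [traceRight, Matrix.single_apply, Finset.sum_sub_distrib, ite_and])
    rw [mul_sub, Matrix.trace_sub, htr, htr, sub_eq_zero] at this
    exact this
  · have := h (Matrix.single (j, g) (i, f) 1) (by
      ext x y
      simp only [traceRight, Matrix.single_apply, Matrix.of_apply, Matrix.zero_apply]
      refine Finset.sum_eq_zero fun k _ => if_neg ?_
      rintro ⟨h₁, h₂⟩
      exact hfg ((Prod.ext_iff.mp h₂).2.trans (Prod.ext_iff.mp h₁).2.symm))
    rw [htr] at this
    exact this

omit [Fintype b] in
lemma posSemidef_of_kronecker_one [DecidableEq b] [Nonempty b] {M : Matrix a a ℂ}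
    (h : (M ⊗ₖ (1 : Matrix b b ℂ)).PosSemidef) : M.PosSemidef := by
  obtain ⟨f⟩ := ‹Nonempty b›
  convert h.submatrix fun i => (i, f)
  ext i j
  simp

lemma exists_traceRight_eq [DecidableEq b] [Nonempty b] (M : Matrix a a ℂ) :
    ∃ X : Matrix (a × b) (a × b) ℂ, traceRight X = M := by
  obtain ⟨f⟩ := ‹Nonempty b›
  exact ⟨M ⊗ₖ Matrix.single f f 1, by rw [traceRight_kronecker]; simp⟩

end traceRight

/-! ### Causal normalization up to scale, and its duality with testers -/

section marginals

variable {P F : Type u} {I O : ℕ → Type u}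

/-- The causal normalization conditions of combs up to the factor `c`: as `IsCombMarginal`, except
that the last operator is `c • 1` on `P`. For varying `c` these operators form the linear span of
the affine space of operators satisfying `IsCombMarginal`. -/
def IsScaledCombMarginal [DecidableEq P] [∀ k, Fintype (I k)] [∀ k, DecidableEq (O k)] :
    (n : ℕ) → ℂ → Matrix (Sys P I O n) (Sys P I O n) ℂ → Prop
  | 0, c, D => D = (c • 1 : Matrix P P ℂ)
  | n + 1, c, D => ∃ E : Matrix (Sys P I O n × I n) (Sys P I O n × I n) ℂ,
      D = E ⊗ₖ (1 : Matrix (O n) (O n) ℂ) ∧ IsScaledCombMarginal n c (traceRight E)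

section basic

variable [DecidableEq P] [∀ k, Fintype (I k)] [∀ k, DecidableEq (O k)]

lemma isCombMarginal_iff (n : ℕ) (D : Matrix (Sys P I O n) (Sys P I O n) ℂ) :
    IsCombMarginal n D ↔ IsScaledCombMarginal n 1 D := by
  induction n with
  | zero => simp only [IsCombMarginal, IsScaledCombMarginal, one_smul]
  | succ n ih => simp only [IsCombMarginal, IsScaledCombMarginal, ih]

namespace IsScaledCombMarginal

lemma zero (n : ℕ) :
    IsScaledCombMarginal n 0 (0 : Matrix (Sys P I O n) (Sys P I O n) ℂ) := by
  induction n with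
  | zero => exact (zero_smul ℂ (1 : Matrix P P ℂ)).symm
  | succ n ih =>
    refine ⟨0, (Matrix.zero_kronecker _).symm, ?_⟩
    convert ih
    ext i j
    simp [traceRight]

lemma add {n : ℕ} {c d : ℂ} {D E : Matrix (Sys P I O n) (Sys P I O n) ℂ}
    (hD : IsScaledCombMarginal n c D) (hE : IsScaledCombMarginal n d E) :
    IsScaledCombMarginal n (c + d) (D + E) := by
  induction n generalizing c d with
  | zero =>
    change D = (c • 1 : Matrix P P ℂ) at hD
    change E = (d • 1 : Matrix P P ℂ) at hE
    subst hD hE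
    exact (add_smul c d (1 : Matrix P P ℂ)).symm
  | succ n ih =>
    obtain ⟨D', rfl, hD'⟩ := hD
    obtain ⟨E', rfl, hE'⟩ := hE
    refine ⟨D' + E', (Matrix.add_kronecker _ _ _).symm, ?_⟩
    rw [traceRight_add]
    exact ih hD' hE'

lemma smul {n : ℕ} {c : ℂ} (d : ℂ) {D : Matrix (Sys P I O n) (Sys P I O n) ℂ}
    (hD : IsScaledCombMarginal n c D) : IsScaledCombMarginal n (d * c) (d • D) := by
  induction n generalizing c with
  | zero =>
    change D = (c • 1 : Matrix P P ℂ) at hD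
    subst hD
    exact smul_smul d c (1 : Matrix P P ℂ)
  | succ n ih =>
    obtain ⟨D', rfl, hD'⟩ := hD
    refine ⟨d • D', (Matrix.smul_kronecker _ _ _).symm, ?_⟩
    rw [traceRight_smul]
    exact ih hD'

lemma conjTranspose {n : ℕ} {c : ℂ} {D : Matrix (Sys P I O n) (Sys P I O n) ℂ}
    (hD : IsScaledCombMarginal n c D) : IsScaledCombMarginal n (star c) Dᴴ := by
  induction n generalizing c with
  | zero =>
    change D = (c • 1 : Matrix P P ℂ) at hD
    subst hD
    change (c • 1 : Matrix P P ℂ)ᴴ = _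
    rw [Matrix.conjTranspose_smul, Matrix.conjTranspose_one]
  | succ n ih =>
    obtain ⟨D', rfl, hD'⟩ := hD
    refine ⟨D'ᴴ, ?_, ?_⟩
    · refine (Matrix.conjTranspose_kronecker D' (1 : Matrix (O n) (O n) ℂ)).trans ?_
      rw [Matrix.conjTranspose_one]
    · rw [traceRight_conjTranspose]
      exact ih hD'

lemma sum {n : ℕ} {ι : Type*} (s : Finset ι) {c : ι → ℂ}
    {D : ι → Matrix (Sys P I O n) (Sys P I O n) ℂ}
    (h : ∀ i ∈ s, IsScaledCombMarginal n (c i) (D i)) :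
    IsScaledCombMarginal n (∑ i ∈ s, c i) (∑ i ∈ s, D i) := by
  classical
  induction s using Finset.induction_on with
  | empty => exact zero n
  | insert i s hi ih =>
    rw [Finset.sum_insert hi, Finset.sum_insert hi]
    exact (h i (Finset.mem_insert_self i s)).add
      (ih fun j hj => h j (Finset.mem_insert_of_mem hj))

end IsScaledCombMarginal

lemma exists_isScaledCombMarginal_one [∀ k, DecidableEq (I k)] (n : ℕ) :
    ∃ c : ℂ, IsScaledCombMarginal n c (1 : Matrix (Sys P I O n) (Sys P I O n) ℂ) := by
  induction n with
  | zero => exact ⟨1, (one_smul ℂ (1 : Matrix P P ℂ)).symm⟩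
  | succ n ih =>
    obtain ⟨c, hc⟩ := ih
    refine ⟨Fintype.card (I n) * c, 1, Matrix.one_kronecker_one.symm, ?_⟩
    rw [← Matrix.one_kronecker_one, traceRight_kronecker, Matrix.trace_one]
    exact hc.smul _

/-- The scale of an operator satisfying the causal conditions is a fixed multiple of its trace. -/
lemma exists_trace_eq_mul [Fintype P] [Nonempty P] [∀ k, Fintype (O k)] [∀ k, Nonempty (O k)]
    (n : ℕ) : ∃ d : ℝ, 0 < d ∧ ∀ (c : ℂ) (M : Matrix (Sys P I O n) (Sys P I O n) ℂ),
      IsScaledCombMarginal n c M → M.trace = d * c := by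
  induction n with
  | zero =>
    refine ⟨Fintype.card P, by exact_mod_cast Fintype.card_pos, fun c M hM => ?_⟩
    change M = (c • 1 : Matrix P P ℂ) at hM
    subst hM
    change Matrix.trace (c • 1 : Matrix P P ℂ) = _
    rw [Matrix.trace_smul, Matrix.trace_one, smul_eq_mul, mul_comm]
    simp
  | succ n ih =>
    obtain ⟨d, hd, h⟩ := ih
    refine ⟨d * Fintype.card (O n), mul_pos hd (by exact_mod_cast Fintype.card_pos),
      fun c M hM => ?_⟩
    obtain ⟨E, rfl, hE⟩ := hM
    have := h c _ hE
    rw [trace_traceRight] at this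
    refine (Matrix.trace_kronecker _ _).trans ?_
    rw [this, Matrix.trace_one]
    push_cast
    ring

end basic

section testers

variable [Fintype P] [DecidableEq P] [∀ k, Fintype (I k)] [∀ k, DecidableEq (I k)]
  [∀ k, Fintype (O k)] [∀ k, DecidableEq (O k)]

lemma IsTesterMarginal.trace_mul {n : ℕ} {c : ℂ} {Ξ M : Matrix (Sys P I O n) (Sys P I O n) ℂ}
    (hΞ : IsTesterMarginal n Ξ) (hM : IsScaledCombMarginal n c M) : (Ξ * M).trace = c := by
  induction n with
  | zero =>
    have key : ∀ A : Matrix P P ℂ, A.trace = 1 → (A * (c • 1 : Matrix P P ℂ)).trace = c := by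
      intro A hA
      rw [Matrix.mul_smul, mul_one, Matrix.trace_smul, hA, smul_eq_mul, mul_one]
    change M = (c • 1 : Matrix P P ℂ) at hM
    subst hM
    exact key Ξ hΞ
  | succ n ih =>
    obtain ⟨Ξ', hΞ', h⟩ := hΞ
    obtain ⟨E, rfl, hE⟩ := hM
    refine (Matrix.trace_mul_comm _ _).trans ?_
    refine (trace_kronecker_one_mul E Ξ).trans ?_
    rw [hΞ', Matrix.trace_mul_comm]
    refine (trace_kronecker_one_mul Ξ' E).trans ?_
    exact ih h hE

lemma exists_eq_kronecker_one_of_trace_mul {n : ℕ} {G : Type u} [Fintype G] [DecidableEq G]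
    [Nonempty G] {T : Matrix (Sys P I O n × G) (Sys P I O n × G) ℂ}
    (h : ∀ (c : ℂ) (D : Matrix (Sys P I O n × G) (Sys P I O n × G) ℂ),
      IsScaledCombMarginal n c (traceRight D) → (T * D).trace = c) :
    ∃ Ξ : Matrix (Sys P I O n) (Sys P I O n) ℂ, T = Ξ ⊗ₖ (1 : Matrix G G ℂ) ∧
      ∀ (c : ℂ) (M : Matrix (Sys P I O n) (Sys P I O n) ℂ),
        IsScaledCombMarginal n c M → (Ξ * M).trace = c := by
  obtain ⟨Ξ, rfl⟩ := exists_eq_kronecker_one T fun D hD => h 0 D (by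
    rw [hD]; exact IsScaledCombMarginal.zero n)
  refine ⟨Ξ, rfl, fun c M hM => ?_⟩
  obtain ⟨D, rfl⟩ := exists_traceRight_eq (b := G) M
  rw [← trace_kronecker_one_mul]
  exact h c D hM

lemma isTesterMarginal_of_trace_mul [∀ k, Nonempty (I k)] {n : ℕ}
    {Ξ : Matrix (Sys P I O n) (Sys P I O n) ℂ}
    (h : ∀ (c : ℂ) (M : Matrix (Sys P I O n) (Sys P I O n) ℂ),
      IsScaledCombMarginal n c M → (Ξ * M).trace = c) : IsTesterMarginal n Ξ := by
  induction n with
  | zero =>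
    have := h 1 (1 : Matrix P P ℂ) (one_smul ℂ (1 : Matrix P P ℂ)).symm
    exact (congrArg (Matrix.trace (n := P)) (mul_one (M := Matrix P P ℂ) Ξ)).symm.trans this
  | succ n ih =>
    obtain ⟨Ξ', hΞ', h'⟩ := exists_eq_kronecker_one_of_trace_mul (n := n) (G := I n)
      (T := traceRight (a := Sys P I O n × I n) (b := O n) Ξ) fun c E hE => by
        refine (Matrix.trace_mul_comm _ _).trans ((trace_kronecker_one_mul E Ξ).symm.trans ?_)
        refine (Matrix.trace_mul_comm _ _).trans ?_
        exact h c _ ⟨E, rfl, hE⟩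
    exact ⟨Ξ', hΞ', ih h'⟩

/-- The affine span of testers is cut out by the normalization of combs: an operator pairing to `c`
with every operator of scale `c` is of the form `Ξ ⊗ 1` with `Ξ` normalized as a tester. -/
lemma exists_isTesterMarginal_of_trace_mul [∀ k, Nonempty (I k)] {n : ℕ} [Fintype F]
    [DecidableEq F] [Nonempty F] {T : Matrix (Sys P I O n × F) (Sys P I O n × F) ℂ}
    (h : ∀ (c : ℂ) (D : Matrix (Sys P I O n × F) (Sys P I O n × F) ℂ),
      IsScaledCombMarginal n c (traceRight D) → (T * D).trace = c) :
    ∃ Ξ : Matrix (Sys P I O n) (Sys P I O n) ℂ, T = Ξ ⊗ₖ (1 : Matrix F F ℂ) ∧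
      IsTesterMarginal n Ξ := by
  obtain ⟨Ξ, hT, hΞ⟩ := exists_eq_kronecker_one_of_trace_mul h
  exact ⟨Ξ, hT, isTesterMarginal_of_trace_mul hΞ⟩

end testers

end marginals

/-! ### The Choi isomorphism -/

/-- The compression of a positive semidefinite matrix along the all-ones vector of `ι`. -/
lemma posSemidef_sum_sum {ι b : Type*} [Fintype ι] [Fintype b] {N : Matrix (ι × b) (ι × b) ℂ}
    (hN : N.PosSemidef) :
    (Matrix.of fun x y : b => ∑ i, ∑ j, N (i, x) (j, y)).PosSemidef := by
  classical
  have h := hN.conjTranspose_mul_mul_same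
    (Matrix.of fun (x : ι × b) (y : b) => if x.2 = y then (1 : ℂ) else 0)
  have e : (Matrix.of fun x y : b => ∑ i, ∑ j, N (i, x) (j, y)) =
      (Matrix.of fun (x : ι × b) (y : b) => if x.2 = y then (1 : ℂ) else 0)ᴴ * N *
        (Matrix.of fun (x : ι × b) (y : b) => if x.2 = y then (1 : ℂ) else 0) := by
    ext x y
    simp only [Matrix.mul_apply, Matrix.conjTranspose_apply, Matrix.of_apply, apply_ite star,
      star_one, star_zero, ite_mul, one_mul, zero_mul, mul_ite, mul_one, mul_zero,
      Fintype.sum_prod_type, Finset.sum_ite_eq', Finset.mem_univ, if_true]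
    exact Finset.sum_comm
  rw [e]
  exact h

section choi

variable {P F : Type u} {I O : ℕ → Type u}

/-- The basis index of `P I₀ O₀ ⋯ Iₙ₋₁ Oₙ₋₁` with given `P O₀ ⋯ Oₙ₋₁` and `I₀ ⋯ Iₙ₋₁` parts. -/
def Sys.merge : (n : ℕ) → InSys P O n → OutSys I n → Sys P I O n
  | 0, p, _ => p
  | n + 1, i, o => ((Sys.merge n i.1 o.1, o.2), i.2)

@[simp] lemma Sys.toIn_merge (n : ℕ) (i : InSys P O n) (o : OutSys I n) :
    Sys.toIn n (Sys.merge n i o) = i := by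
  induction n with
  | zero => rfl
  | succ n ih => exact Prod.ext (ih i.1 o.1) rfl

@[simp] lemma Sys.toOut_merge (n : ℕ) (i : InSys P O n) (o : OutSys I n) :
    Sys.toOut n (Sys.merge n i o) = o := by
  induction n with
  | zero => rfl
  | succ n ih => exact Prod.ext (ih i.1 o.1) rfl

@[simp] lemma Sys.merge_toIn_toOut (n : ℕ) (x : Sys P I O n) :
    Sys.merge n (Sys.toIn n x) (Sys.toOut n x) = x := by
  induction n with
  | zero => rfl
  | succ n ih => exact Prod.ext (Prod.ext (ih x.1.1) rfl) rfl

instance instFintypeInSys [Fintype P] [∀ k, Fintype (O k)] : (n : ℕ) → Fintype (InSys P O n)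
  | 0 => inferInstanceAs (Fintype P)
  | n + 1 =>
    haveI := instFintypeInSys n
    inferInstanceAs (Fintype (InSys P O n × O n))

instance instFintypeOutSys [∀ k, Fintype (I k)] : (n : ℕ) → Fintype (OutSys I n)
  | 0 => inferInstanceAs (Fintype PUnit)
  | n + 1 =>
    haveI := instFintypeOutSys n
    inferInstanceAs (Fintype (OutSys I n × I n))

section linear

variable [DecidableEq P] [∀ k, DecidableEq (O k)]

lemma choi_add (n : ℕ) (C D : Supermap P F I O n) : choi n (C + D) = choi n C + choi n D := rfl

lemma choi_smul (n : ℕ) (c : ℂ) (C : Supermap P F I O n) : choi n (c • C) = c • choi n C := rfl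

lemma choi_sub (n : ℕ) (C D : Supermap P F I O n) : choi n (C - D) = choi n C - choi n D := rfl

lemma choi_sum (n : ℕ) {ι : Type*} (s : Finset ι) (C : ι → Supermap P F I O n) :
    choi n (∑ i ∈ s, C i) = ∑ i ∈ s, choi n (C i) := by
  classical
  induction s using Finset.induction_on with
  | empty => rfl
  | insert i s hi ih => rw [Finset.sum_insert hi, Finset.sum_insert hi, choi_add, ih]

end linear

variable [Fintype P] [DecidableEq P] [∀ k, Fintype (O k)] [∀ k, DecidableEq (O k)]

/-- The supermap with a given Choi operator. -/
def ofChoi (n : ℕ) (X : Matrix (Sys P I O n × F) (Sys P I O n × F) ℂ) : Supermap P F I O n where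
  toFun ρ := Matrix.of fun x y => ∑ i, ∑ j,
    ρ i j * X (Sys.merge n i x.1, x.2) (Sys.merge n j y.1, y.2)
  map_add' ρ σ := by
    ext x y
    simp [add_mul, Finset.sum_add_distrib]
  map_smul' c ρ := by
    ext x y
    simp [mul_assoc, Finset.mul_sum]

lemma choi_ofChoi (n : ℕ) (X : Matrix (Sys P I O n × F) (Sys P I O n × F) ℂ) :
    choi n (ofChoi n X) = X := by
  ext x y
  simp [choi, ofChoi, Matrix.single_apply, ite_and]

lemma ofChoi_choi (n : ℕ) (C : Supermap P F I O n) : ofChoi n (choi n C) = C := by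
  refine LinearMap.ext fun ρ => ?_
  ext x y
  conv_rhs => rw [Matrix.matrix_eq_sum_single ρ]
  simp only [ofChoi, choi, LinearMap.coe_mk, AddHom.coe_mk, Matrix.of_apply, Sys.toIn_merge,
    Sys.toOut_merge, map_sum, Matrix.sum_apply]
  refine Finset.sum_congr rfl fun i _ => Finset.sum_congr rfl fun j _ => ?_
  have : Matrix.single i j (ρ i j) = ρ i j • Matrix.single i j (1 : ℂ) := by simp
  rw [this, map_smul, Matrix.smul_apply, smul_eq_mul]

lemma choi_injective (n : ℕ) :
    Function.Injective (choi n : Supermap P F I O n → _) :=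
  Function.LeftInverse.injective (ofChoi_choi n)

/-- Apply complete positivity to the maximally entangled state of the input and a copy of it. -/
lemma IsCP.posSemidef_choi {n : ℕ} {C : Supermap P F I O n} (hC : IsCP C) :
    (choi n C).PosSemidef := by
  classical
  let e := Fintype.equivFin (InSys P O n)
  let v : Fin (Fintype.card (InSys P O n)) × InSys P O n → ℂ :=
    fun x => if e.symm x.1 = x.2 then 1 else 0
  have h := hC _ _ (Matrix.posSemidef_vecMulVec_self_star v)
  convert h.submatrix fun x : Sys P I O n × F => (e (Sys.toIn n x.1), (Sys.toOut n x.1, x.2))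
    using 1
  ext x y
  simp only [choi, Matrix.of_apply, Matrix.submatrix_apply]
  refine congrArg (fun ρ => C ρ (Sys.toOut n x.1, x.2) (Sys.toOut n y.1, y.2)) ?_
  ext i j
  simp only [Matrix.single_apply, Matrix.of_apply, Matrix.vecMulVec_apply, v, Pi.star_apply,
    Equiv.symm_apply_apply, ite_and]
  split_ifs <;> simp

lemma isCP_of_posSemidef_choi [∀ k, Fintype (I k)] [Fintype F] {n : ℕ} {C : Supermap P F I O n}
    (hC : (choi n C).PosSemidef) : IsCP C := by
  intro r X hX
  have hZ : ((choi n C).submatrix (fun x : InSys P O n × (OutSys I n × F) =>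
      (Sys.merge n x.1 x.2.1, x.2.2)) (fun x => (Sys.merge n x.1 x.2.1, x.2.2))).PosSemidef :=
    hC.submatrix _
  have h := posSemidef_sum_sum ((hX.kronecker hZ).submatrix
    fun x : InSys P O n × (Fin r × (OutSys I n × F)) => ((x.2.1, x.1), (x.1, x.2.2)))
  nth_rewrite 1 [← ofChoi_choi n C]
  exact h

end choi

/-! ### Extension of positive functionals on matrices -/

section riesz

variable {a : Type u} [Fintype a] [DecidableEq a]

/-- A real-linear functional that is nonnegative on the matrices with positive semidefinite
Hermitian part is `X ↦ Re tr (T X)` with `T` positive semidefinite. -/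
lemma exists_posSemidef_of_functional (f : Matrix a a ℂ →ₗ[ℝ] ℝ)
    (hf : ∀ X : Matrix a a ℂ, (X + Xᴴ).PosSemidef → 0 ≤ f X) :
    ∃ T : Matrix a a ℂ, T.PosSemidef ∧ ∀ X, f X = (T * X).trace.re := by
  have hskew : ∀ X : Matrix a a ℂ, X + Xᴴ = 0 → f X = 0 := by
    intro X hX
    refine le_antisymm ?_ (hf X (hX ▸ Matrix.PosSemidef.zero))
    have hX' : -X + (-X)ᴴ = 0 := by
      rw [Matrix.conjTranspose_neg, ← neg_add, hX, neg_zero]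
    have := hf (-X) (hX' ▸ Matrix.PosSemidef.zero)
    rw [map_neg] at this
    linarith
  -- the complex-linear functional with real part `f`
  let Φ : Matrix a a ℂ →ₗ[ℂ] ℂ := Module.Dual.extendRCLike f
  have hΦ : ∀ X, Φ X = (f X : ℂ) - Complex.I * (f (Complex.I • X) : ℂ) := fun X =>
    Module.Dual.extendRCLike_apply f X
  let T : Matrix a a ℂ := Matrix.of fun j i => Φ (Matrix.single i j 1)
  have hT : ∀ X, (T * X).trace = Φ X := by
    intro X
    conv_rhs => rw [Matrix.matrix_eq_sum_single X]
    simp only [Matrix.trace, Matrix.diag, Matrix.mul_apply, map_sum]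
    rw [Finset.sum_comm]
    refine Finset.sum_congr rfl fun i _ => Finset.sum_congr rfl fun j _ => ?_
    have : Matrix.single i j (X i j) = X i j • Matrix.single i j (1 : ℂ) := by simp
    rw [this, map_smul, smul_eq_mul, mul_comm]
    rfl
  have hTh : T.IsHermitian := by
    ext i j
    have h₁ := hskew (Matrix.single j i 1 - Matrix.single i j 1) (by simp)
    have h₂ := hskew (Complex.I • (Matrix.single j i 1 + Matrix.single i j 1)) (by
      simp only [Matrix.conjTranspose_smul, Matrix.conjTranspose_add,
        Matrix.conjTranspose_single, star_one, Complex.star_def, Complex.conj_I]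
      module)
    rw [map_sub, sub_eq_zero] at h₁
    rw [smul_add, map_add, add_eq_zero_iff_eq_neg] at h₂
    simp only [Matrix.conjTranspose_apply, T, Matrix.of_apply, hΦ, h₁, h₂]
    simp [sub_eq_add_neg]
  refine ⟨T, Matrix.PosSemidef.of_dotProduct_mulVec_nonneg hTh fun x => ?_, fun X => ?_⟩
  · have hx := Matrix.posSemidef_vecMulVec_self_star (R := ℂ) x
    have e : star x ⬝ᵥ T *ᵥ x = (T * Matrix.vecMulVec x (star x)).trace := by
      rw [Matrix.mul_vecMulVec, Matrix.trace_vecMulVec, dotProduct_comm]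
    have h₁ := hf (Matrix.vecMulVec x (star x)) (by
      rw [hx.1.eq]; exact hx.add hx)
    have h₂ := hskew (Complex.I • Matrix.vecMulVec x (star x)) (by
      rw [Matrix.conjTranspose_smul, hx.1.eq, Complex.star_def, Complex.conj_I]
      module)
    rw [e, hT, hΦ, h₂, Complex.ofReal_zero, mul_zero, sub_zero]
    exact_mod_cast h₁
  · rw [hT, hΦ]
    simp

lemma exists_posSemidef_smul_one_add {H : Matrix a a ℂ} (hH : H.IsHermitian) :
    ∃ t₀ : ℝ, ∀ t : ℝ, t₀ ≤ t → ((t : ℂ) • 1 + H).PosSemidef := by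
  have hH' : IsSelfAdjoint H := hH
  obtain ⟨m, hm⟩ := (Matrix.finite_real_spectrum (A := H)).bddBelow
  refine ⟨-m, fun t ht => ?_⟩
  have e : (t : ℂ) • 1 + H = cfc (fun x : ℝ => t + x) H := by
    rw [cfc_const_add t (fun x => x) H]
    congr 1
    · rw [Algebra.algebraMap_eq_smul_one]
      exact Complex.coe_smul t _
    · exact (cfc_id' ℝ H).symm
  rw [e, ← Matrix.nonneg_iff_posSemidef]
  refine cfc_nonneg fun x hx => ?_
  have := hm hx
  linarith

/-- M. Riesz's extension theorem for pairs of matrices: a functional that is nonnegative on the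
pairs of positive matrices in a real subspace containing `(1, 1)` is given on this subspace by a
pair of positive semidefinite matrices. -/
lemma exists_posSemidef_pair (W : Submodule ℝ (Matrix a a ℂ × Matrix a a ℂ))
    (φ : Matrix a a ℂ × Matrix a a ℂ →ₗ[ℝ] ℝ) (hone : (1, 1) ∈ W)
    (hφ : ∀ X Y, (X, Y) ∈ W → (X + Xᴴ).PosSemidef → (Y + Yᴴ).PosSemidef → 0 ≤ φ (X, Y)) :
    ∃ T₁ T₂ : Matrix a a ℂ, T₁.PosSemidef ∧ T₂.PosSemidef ∧ ∀ X Y, (X, Y) ∈ W →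
      φ (X, Y) = (T₁ * X).trace.re + (T₂ * Y).trace.re := by
  have hsmul : ∀ (r : ℝ) (X : Matrix a a ℂ), r • X + (r • X)ᴴ = (r : ℂ) • (X + Xᴴ) := by
    intro r X
    rw [← Complex.coe_smul r X, Matrix.conjTranspose_smul, smul_add]
    simp
  let s : PointedCone ℝ (Matrix a a ℂ × Matrix a a ℂ) :=
    { carrier := {Z | (Z.1 + Z.1ᴴ).PosSemidef ∧ (Z.2 + Z.2ᴴ).PosSemidef}
      add_mem' := by
        rintro Z Z' ⟨h₁, h₂⟩ ⟨h₁', h₂'⟩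
        refine ⟨?_, ?_⟩
        · rw [Prod.fst_add, Matrix.conjTranspose_add, add_add_add_comm]
          exact h₁.add h₁'
        · rw [Prod.snd_add, Matrix.conjTranspose_add, add_add_add_comm]
          exact h₂.add h₂'
      zero_mem' := by
        simp [Matrix.PosSemidef.zero]
      smul_mem' := by
        rintro ⟨r, hr⟩ Z ⟨h₁, h₂⟩
        have hr' : (0 : ℂ) ≤ (r : ℂ) := by exact_mod_cast hr
        refine ⟨?_, ?_⟩
        · change (r • Z.1 + (r • Z.1)ᴴ).PosSemidef
          rw [hsmul]
          exact h₁.smul hr'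
        · change (r • Z.2 + (r • Z.2)ᴴ).PosSemidef
          rw [hsmul]
          exact h₂.smul hr' }
  obtain ⟨g, hg, hgs⟩ := riesz_extension s ⟨W, φ.comp W.subtype⟩
    (fun x hx => hφ _ _ x.2 hx.1 hx.2) (by
      rintro ⟨X, Y⟩
      have hX : (X + Xᴴ).IsHermitian := Matrix.isHermitian_add_transpose_self X
      have hY : (Y + Yᴴ).IsHermitian := Matrix.isHermitian_add_transpose_self Y
      obtain ⟨t₁, ht₁⟩ := exists_posSemidef_smul_one_add hX
      obtain ⟨t₂, ht₂⟩ := exists_posSemidef_smul_one_add hY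
      obtain ⟨t, h₁, h₂⟩ : ∃ t : ℝ, t₁ ≤ 2 * t ∧ t₂ ≤ 2 * t :=
        ⟨max t₁ t₂ / 2, by linarith [le_max_left t₁ t₂], by linarith [le_max_right t₁ t₂]⟩
      refine ⟨⟨t • (1, 1), W.smul_mem t hone⟩, ?_, ?_⟩
      · change ((t • (1 : Matrix a a ℂ) + X) + (t • (1 : Matrix a a ℂ) + X)ᴴ).PosSemidef
        rw [Matrix.conjTranspose_add, add_add_add_comm, hsmul]
        convert ht₁ _ h₁ using 2
        simp only [Matrix.conjTranspose_one, Complex.ofReal_mul, Complex.ofReal_ofNat]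
        module
      · change ((t • (1 : Matrix a a ℂ) + Y) + (t • (1 : Matrix a a ℂ) + Y)ᴴ).PosSemidef
        rw [Matrix.conjTranspose_add, add_add_add_comm, hsmul]
        convert ht₂ _ h₂ using 2
        simp only [Matrix.conjTranspose_one, Complex.ofReal_mul, Complex.ofReal_ofNat]
        module)
  obtain ⟨T₁, hT₁, h₁⟩ := exists_posSemidef_of_functional
    (g.comp (LinearMap.inl ℝ (Matrix a a ℂ) (Matrix a a ℂ))) fun X hX => hgs (X, 0) ⟨hX, by
      simp [Matrix.PosSemidef.zero]⟩
  obtain ⟨T₂, hT₂, h₂⟩ := exists_posSemidef_of_functional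
    (g.comp (LinearMap.inr ℝ (Matrix a a ℂ) (Matrix a a ℂ))) fun X hX => hgs (0, X) ⟨by
      simp [Matrix.PosSemidef.zero], hX⟩
  refine ⟨T₁, T₂, hT₁, hT₂, fun X Y hXY => ?_⟩
  rw [← h₁, ← h₂, LinearMap.comp_apply, LinearMap.comp_apply, LinearMap.inl_apply,
    LinearMap.inr_apply, ← map_add, Prod.mk_add_mk, add_zero, zero_add]
  exact (hg ⟨(X, Y), hXY⟩).symm

end riesz

/-! ### Compactness -/

section compact

variable {a : Type u} [Fintype a]

lemma isClosed_setOf_posSemidef : IsClosed {X : Matrix a a ℂ | X.PosSemidef} := by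
  have e : {X : Matrix a a ℂ | X.PosSemidef} =
      {X | Xᴴ = X} ∩ ⋂ x : a → ℂ, {X | 0 ≤ star x ⬝ᵥ X *ᵥ x} := by
    ext X
    simp only [Set.mem_ofPred_eq, Set.mem_inter_iff, Set.mem_iInter]
    exact Matrix.posSemidef_iff_dotProduct_mulVec
  rw [e]
  refine (isClosed_eq (by fun_prop) continuous_id).inter (isClosed_iInter fun x => ?_)
  exact isClosed_le continuous_const (by fun_prop)

lemma norm_apply_le_trace {X : Matrix a a ℂ} (hX : X.PosSemidef) (i j : a) :
    ‖X i j‖ ≤ X.trace.re := by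
  classical
  obtain ⟨D, rfl⟩ := CStarAlgebra.nonneg_iff_eq_star_mul_self.mp
    (Matrix.nonneg_iff_posSemidef.mpr hX)
  have htr : (star D * D).trace.re = ∑ l, ∑ k, ‖D k l‖ ^ 2 := by
    simp only [Matrix.trace, Matrix.diag, Matrix.mul_apply, Matrix.star_apply, Complex.re_sum,
      Complex.star_def, Complex.conj_mul', ← Complex.ofReal_pow, Complex.ofReal_re]
  have hle : ∀ l, ∑ k, ‖D k l‖ ^ 2 ≤ (star D * D).trace.re := fun l => by
    rw [htr]
    exact Finset.single_le_sum (f := fun l => ∑ k, ‖D k l‖ ^ 2)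
      (fun _ _ => Finset.sum_nonneg fun _ _ => sq_nonneg _) (Finset.mem_univ l)
  have h : ‖(star D * D) i j‖ ≤ ∑ k, (‖D k i‖ ^ 2 + ‖D k j‖ ^ 2) / 2 := by
    rw [Matrix.mul_apply]
    refine (norm_sum_le _ _).trans (Finset.sum_le_sum fun k _ => ?_)
    rw [norm_mul, Matrix.star_apply, norm_star]
    nlinarith [sq_nonneg (‖D k i‖ - ‖D k j‖)]
  rw [← Finset.sum_div, Finset.sum_add_distrib] at h
  linarith [hle i, hle j]

lemma isCompact_setOf_posSemidef_trace_le (r : ℝ) :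
    IsCompact {X : Matrix a a ℂ | X.PosSemidef ∧ X.trace.re ≤ r} := by
  have hK : IsCompact (Set.univ.pi fun _ : a =>
      Set.univ.pi fun _ : a => Metric.closedBall (0 : ℂ) r) :=
    isCompact_univ_pi fun _ => isCompact_univ_pi fun _ => isCompact_closedBall _ _
  refine hK.of_isClosed_subset (isClosed_setOf_posSemidef.inter
    (isClosed_le (Complex.continuous_re.comp continuous_id.matrix_trace) continuous_const)) ?_
  rintro X ⟨hX, hr⟩ i - j -
  rw [mem_closedBall_zero_iff]
  exact (norm_apply_le_trace hX i j).trans hr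

end compact

/-! ### The base norm as a conic program -/

section duality

variable {P F : Type u} {I O : ℕ → Type u}
  [Fintype P] [DecidableEq P] [Fintype F]
  [∀ k, Fintype (I k)] [∀ k, Fintype (O k)] [∀ k, DecidableEq (O k)]

lemma isComb_iff {n : ℕ} {C : Supermap P F I O n} :
    IsComb n C ↔ (choi n C).PosSemidef ∧ IsScaledCombMarginal n 1 (traceRight (choi n C)) :=
  ⟨fun h => ⟨IsCP.posSemidef_choi h.cp, (isCombMarginal_iff n _).mp h.marginal⟩,
    fun h => ⟨isCP_of_posSemidef_choi h.1, (isCombMarginal_iff n _).mpr h.2⟩⟩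

namespace IsVirtualComb

variable {n : ℕ} {C : Supermap P F I O n}

omit [Fintype P] [∀ k, Fintype (O k)] in
lemma exists_isComb (hC : IsVirtualComb n C) : ∃ D : Supermap P F I O n, IsComb n D := by
  obtain ⟨m, α, D, hD, hα, -⟩ := hC
  cases m with
  | zero => simp at hα
  | succ m => exact ⟨D 0, hD 0⟩

lemma isHermitian_choi (hC : IsVirtualComb n C) : (choi n C).IsHermitian := by
  obtain ⟨m, α, D, hD, -, rfl⟩ := hC
  rw [choi_sum, Matrix.IsHermitian, Matrix.conjTranspose_sum]
  refine Finset.sum_congr rfl fun i _ => ?_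
  rw [choi_smul, Matrix.conjTranspose_smul, (isComb_iff.mp (hD i)).1.1.eq]
  simp

lemma marginal (hC : IsVirtualComb n C) :
    IsScaledCombMarginal n 1 (traceRight (choi n C)) := by
  obtain ⟨m, α, D, hD, hα, rfl⟩ := hC
  have h := IsScaledCombMarginal.sum Finset.univ fun i _ =>
    (isComb_iff.mp (hD i)).2.smul (α i : ℂ)
  have hα' : ∑ i, (α i : ℂ) * 1 = 1 := by
    simp only [mul_one]
    exact_mod_cast hα
  rw [hα'] at h
  convert h
  rw [choi_sum]
  simp only [choi_smul, ← traceRight_smul]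
  ext i j
  simp only [traceRight, Matrix.of_apply, Matrix.sum_apply]
  exact Finset.sum_comm

end IsVirtualComb

section scale

variable [Nonempty P] [∀ k, Nonempty (O k)]

lemma IsScaledCombMarginal.exists_eq_ofReal {n : ℕ} {c : ℂ}
    {X : Matrix (Sys P I O n × F) (Sys P I O n × F) ℂ} (hX : X.PosSemidef)
    (h : IsScaledCombMarginal n c (traceRight X)) : ∃ r : ℝ, 0 ≤ r ∧ c = r := by
  obtain ⟨d, hd, hdt⟩ := exists_trace_eq_mul (P := P) (I := I) (O := O) n
  have e := hdt c _ h
  rw [trace_traceRight] at e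
  obtain ⟨h₁, h₂⟩ := Complex.le_def.mp hX.trace_nonneg
  rw [e, Complex.re_ofReal_mul] at h₁
  rw [e, Complex.im_ofReal_mul] at h₂
  refine ⟨c.re, nonneg_of_mul_nonneg_right h₁ hd, Complex.ext rfl ?_⟩
  rw [Complex.ofReal_im]
  exact (mul_eq_zero.mp h₂.symm).resolve_left hd.ne'

lemma exists_isComb_smul {n : ℕ} (hcomb : ∃ D : Supermap P F I O n, IsComb n D) {r : ℝ}
    {X : Matrix (Sys P I O n × F) (Sys P I O n × F) ℂ} (hX : X.PosSemidef)
    (h : IsScaledCombMarginal n r (traceRight X)) (hr : 0 ≤ r) :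
    ∃ D : Supermap P F I O n, IsComb n D ∧ X = (r : ℂ) • choi n D := by
  rcases hr.eq_or_lt with rfl | hr
  · obtain ⟨D, hD⟩ := hcomb
    refine ⟨D, hD, ?_⟩
    obtain ⟨d, -, hdt⟩ := exists_trace_eq_mul (P := P) (I := I) (O := O) n
    have e := hdt _ _ h
    rw [trace_traceRight, Complex.ofReal_zero, mul_zero, hX.trace_eq_zero_iff] at e
    rw [e, Complex.ofReal_zero, zero_smul]
  · have hr' : (r : ℂ) ≠ 0 := by exact_mod_cast hr.ne'
    refine ⟨ofChoi n ((r : ℂ)⁻¹ • X), isComb_iff.mpr ?_, ?_⟩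
    · rw [choi_ofChoi]
      refine ⟨hX.smul ?_, ?_⟩
      · rw [← Complex.ofReal_inv, Complex.zero_le_real]
        positivity
      · rw [traceRight_smul, ← inv_mul_cancel₀ hr']
        exact h.smul _
    · rw [choi_ofChoi, smul_smul, mul_inv_cancel₀ hr', one_smul]

lemma mem_baseNormValues_iff {n : ℕ} (hcomb : ∃ D : Supermap P F I O n, IsComb n D)
    {C : Supermap P F I O n} {v : ℝ} :
    v ∈ baseNormValues n C ↔ ∃ (X Y : Matrix (Sys P I O n × F) (Sys P I O n × F) ℂ) (r s : ℝ),
      X.PosSemidef ∧ Y.PosSemidef ∧ IsScaledCombMarginal n r (traceRight X) ∧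
      IsScaledCombMarginal n s (traceRight Y) ∧ choi n C = X - Y ∧ v = r + s := by
  constructor
  · rintro ⟨r, s, D, E, hr, hs, hD, hE, rfl, rfl⟩
    rw [isComb_iff] at hD hE
    refine ⟨(r : ℂ) • choi n D, (s : ℂ) • choi n E, r, s,
      hD.1.smul (Complex.zero_le_real.mpr hr), hE.1.smul (Complex.zero_le_real.mpr hs), ?_, ?_,
      rfl, rfl⟩
    · simpa only [traceRight_smul, mul_one] using hD.2.smul (r : ℂ)
    · simpa only [traceRight_smul, mul_one] using hE.2.smul (s : ℂ)
  · rintro ⟨X, Y, r, s, hX, hY, hXm, hYm, hC, rfl⟩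
    have hr : 0 ≤ r := by
      obtain ⟨r', hr', e⟩ := hXm.exists_eq_ofReal hX
      rwa [Complex.ofReal_inj.mp e]
    have hs : 0 ≤ s := by
      obtain ⟨s', hs', e⟩ := hYm.exists_eq_ofReal hY
      rwa [Complex.ofReal_inj.mp e]
    obtain ⟨D, hD, rfl⟩ := exists_isComb_smul hcomb hX hXm hr
    obtain ⟨E, hE, rfl⟩ := exists_isComb_smul hcomb hY hYm hs
    refine ⟨r, s, D, E, hr, hs, hD, hE, choi_injective n ?_, rfl⟩
    rw [hC, choi_sub, choi_smul, choi_smul]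

end scale

/-- The complex span of the Choi operators of virtual combs. -/
def combSpan (n : ℕ) : Submodule ℂ (Matrix (Sys P I O n × F) (Sys P I O n × F) ℂ) where
  carrier := {X | ∃ c, IsScaledCombMarginal n c (traceRight X)}
  add_mem' := by
    rintro X Y ⟨c, hc⟩ ⟨d, hd⟩
    exact ⟨c + d, by rw [traceRight_add]; exact hc.add hd⟩
  zero_mem' := ⟨0, by
    rw [← zero_smul ℂ (0 : Matrix (Sys P I O n × F) (Sys P I O n × F) ℂ), traceRight_smul,
      zero_smul]
    exact IsScaledCombMarginal.zero n⟩
  smul_mem' := by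
    rintro d X ⟨c, hc⟩
    exact ⟨d * c, by rw [traceRight_smul]; exact hc.smul d⟩

section attained

variable [DecidableEq F] [∀ k, DecidableEq (I k)]

omit [Fintype P] [∀ k, Fintype (O k)] in
lemma one_mem_combSpan (n : ℕ) :
    (1 : Matrix (Sys P I O n × F) (Sys P I O n × F) ℂ) ∈ combSpan n := by
  obtain ⟨c, hc⟩ := exists_isScaledCombMarginal_one (P := P) (I := I) (O := O) n
  refine ⟨Fintype.card F * c, ?_⟩
  rw [← Matrix.one_kronecker_one, traceRight_kronecker, Matrix.trace_one]
  exact hc.smul _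

variable [Nonempty P] [∀ k, Nonempty (O k)]

/-- In a decomposition `𝖢 = X - Y` the value is an increasing function of `tr X`, and the feasible
`X` with `tr X` bounded form a compact set. -/
lemma exists_isLeast_baseNormValues {n : ℕ} {C : Supermap P F I O n} (hC : IsVirtualComb n C) :
    ∃ β, IsLeast (baseNormValues n C) β := by
  have hcomb := hC.exists_isComb
  obtain ⟨d, hd, hdt⟩ := exists_trace_eq_mul (P := P) (I := I) (O := O) n
  have htr : ∀ {r : ℝ} {X : Matrix (Sys P I O n × F) (Sys P I O n × F) ℂ},
      IsScaledCombMarginal n r (traceRight X) → X.trace.re = d * r := fun h => by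
    rw [← trace_traceRight, hdt _ _ h, ← Complex.ofReal_mul, Complex.ofReal_re]
  have hval : ∀ {r s : ℝ} {X Y : Matrix (Sys P I O n × F) (Sys P I O n × F) ℂ},
      IsScaledCombMarginal n r (traceRight X) → IsScaledCombMarginal n s (traceRight Y) →
      choi n C = X - Y → r + s = 2 * (X.trace.re / d) - 1 := by
    intro r s X Y hX hY h
    have hC1 : (choi n C).trace.re = d * 1 := htr (by simpa using hC.marginal)
    rw [h, Matrix.trace_sub, Complex.sub_re, htr hX, htr hY] at hC1
    have : r - s = 1 := mul_left_cancel₀ hd.ne' (by linarith)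
    rw [htr hX, mul_div_cancel_left₀ _ hd.ne']
    linarith
  obtain ⟨t₀, ht₀⟩ := exists_posSemidef_smul_one_add hC.isHermitian_choi
  set A : Matrix (Sys P I O n × F) (Sys P I O n × F) ℂ :=
    ((t₀ ⊔ 0 : ℝ) : ℂ) • 1 + choi n C with hA
  let K : Set (Matrix (Sys P I O n × F) (Sys P I O n × F) ℂ) :=
    ({X | X.PosSemidef ∧ X.trace.re ≤ A.trace.re} ∩ {X | (X - choi n C).PosSemidef}) ∩
      {X | X ∈ combSpan n}
  have hK : IsCompact K := by
    refine ((isCompact_setOf_posSemidef_trace_le _).inter_right ?_).inter_right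
      (Submodule.closed_of_finiteDimensional (combSpan n))
    exact isClosed_setOf_posSemidef.preimage (continuous_id.sub continuous_const)
  have hCs : choi n C ∈ combSpan n := ⟨1, hC.marginal⟩
  have hAK : A ∈ K := by
    refine ⟨⟨⟨ht₀ _ le_sup_left, le_rfl⟩, ?_⟩,
      (combSpan n).add_mem ((combSpan n).smul_mem _ (one_mem_combSpan n)) hCs⟩
    change (A - choi n C).PosSemidef
    rw [hA, add_sub_cancel_right]
    exact Matrix.PosSemidef.one.smul (Complex.zero_le_real.mpr le_sup_right)
  obtain ⟨X₀, hX₀, hmin⟩ := hK.exists_isMinOn ⟨A, hAK⟩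
    (f := fun X => X.trace.re) (Complex.continuous_re.comp continuous_id.matrix_trace).continuousOn
  obtain ⟨⟨⟨hX₀p, hX₀t⟩, hX₀C⟩, c, hc⟩ := hX₀
  change (X₀ - choi n C).PosSemidef at hX₀C
  obtain ⟨r, -, rfl⟩ := hc.exists_eq_ofReal hX₀p
  have hs : IsScaledCombMarginal n ((r - 1 : ℝ) : ℂ) (traceRight (X₀ - choi n C)) := by
    rw [sub_eq_add_neg X₀, ← neg_one_smul ℂ (choi n C), traceRight_add, traceRight_smul]
    convert hc.add (hC.marginal.smul (-1)) using 1
    push_cast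
    ring
  have hdec : choi n C = X₀ - (X₀ - choi n C) := (sub_sub_cancel _ _).symm
  refine ⟨r + (r - 1), (mem_baseNormValues_iff hcomb).mpr
    ⟨X₀, X₀ - choi n C, r, r - 1, hX₀p, hX₀C, hc, hs, hdec, rfl⟩, ?_⟩
  intro v hv
  obtain ⟨X, Y, r', s', hX, hY, hXm, hYm, h, rfl⟩ := (mem_baseNormValues_iff hcomb).mp hv
  rw [hval hXm hYm h, hval hc hs hdec]
  have hle : X₀.trace.re ≤ X.trace.re := by
    rcases le_total X.trace.re A.trace.re with hXA | hXA
    · refine hmin ⟨⟨⟨hX, hXA⟩, ?_⟩, _, hXm⟩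
      change (X - choi n C).PosSemidef
      rwa [h, sub_sub_cancel]
    · exact hX₀t.trans hXA
  have := div_le_div_of_nonneg_right hle hd.le
  linarith

end attained

/-! ### Duality between the base norm and the diamond norm -/

section testers

variable [DecidableEq F] [Nonempty F] [∀ k, DecidableEq (I k)]

lemma sqrt_kronecker_one_mul_self {a b : Type u} [Fintype a] [DecidableEq a] [Fintype b]
    [DecidableEq b] {Ξ : Matrix a a ℂ} (hΞ : Ξ.PosSemidef) :
    (CFC.sqrt Ξ ⊗ₖ (1 : Matrix b b ℂ)) * (CFC.sqrt Ξ ⊗ₖ (1 : Matrix b b ℂ)) =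
      Ξ ⊗ₖ (1 : Matrix b b ℂ) := by
  rw [← Matrix.mul_kronecker_mul, mul_one,
    CFC.sqrt_mul_sqrt_self Ξ (Matrix.nonneg_iff_posSemidef.mpr hΞ)]

lemma posSemidef_sqrt_kronecker_one {a b : Type u} [Fintype a] [DecidableEq a] [Fintype b]
    [DecidableEq b] (Ξ : Matrix a a ℂ) :
    (CFC.sqrt Ξ ⊗ₖ (1 : Matrix b b ℂ)).PosSemidef :=
  (Matrix.nonneg_iff_posSemidef.mp (CFC.sqrt_nonneg Ξ)).kronecker Matrix.PosSemidef.one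

omit [DecidableEq P] [Fintype F] [∀ k, Fintype (I k)] [∀ k, DecidableEq (O k)] in
lemma IsTester.posSemidef_marginal {n m : ℕ}
    {T : Fin m → Matrix (Sys P I O n × F) (Sys P I O n × F) ℂ}
    {Ξ : Matrix (Sys P I O n) (Sys P I O n) ℂ} (h : IsTester n T Ξ) : Ξ.PosSemidef := by
  refine posSemidef_of_kronecker_one (b := F) ?_
  rw [← h.sum_eq]
  exact Matrix.posSemidef_sum _ fun i _ => h.posSemidef i

/-- Weak duality: after conjugation with `√Ξ ⊗ 1` a comb has trace one. -/
lemma diamond_le_base [Nonempty P] [∀ k, Nonempty (O k)] {n : ℕ} {C : Supermap P F I O n}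
    (hC : IsVirtualComb n C) {v w : ℝ} (hv : v ∈ baseNormValues n C)
    (hw : w ∈ diamondNormValues n C) : w ≤ v := by
  obtain ⟨X, Y, r, s, hX, hY, hXm, hYm, h, rfl⟩ :=
    (mem_baseNormValues_iff hC.exists_isComb).mp hv
  obtain ⟨m, T, Ξ, hT, rfl⟩ := hw
  set R := CFC.sqrt Ξ ⊗ₖ (1 : Matrix F F ℂ) with hR
  have hRp : R.PosSemidef := posSemidef_sqrt_kronecker_one Ξ
  have hconj : ∀ {Z : Matrix (Sys P I O n × F) (Sys P I O n × F) ℂ}, Z.PosSemidef →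
      (R * Z * R).PosSemidef := fun hZ => by
    have := hZ.conjTranspose_mul_mul_same R
    rwa [hRp.1.eq] at this
  have htr : ∀ {Z : Matrix (Sys P I O n × F) (Sys P I O n × F) ℂ} {q : ℝ},
      IsScaledCombMarginal n q (traceRight Z) → (R * Z * R).trace.re = q := fun hZ => by
    rw [Matrix.trace_mul_comm, ← mul_assoc, sqrt_kronecker_one_mul_self hT.posSemidef_marginal,
      trace_kronecker_one_mul, hT.marginal.trace_mul hZ, Complex.ofReal_re]
  rw [h, mul_sub, sub_mul, ← htr hXm, ← htr hYm]
  exact traceNorm_sub_le (hconj hX) (hconj hY)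

/-- Strong duality. The optimal pair `T₁, T₂` comes from extending the functional
`(X, Y) ↦ (h (X + Y) + β h (X - Y)) / 2`, where `h` is the normalization of combs, from the pairs
with `X + Y` in the span of combs and `X - Y` a real multiple of `𝖢`. On positive pairs of this
kind it is nonnegative by minimality of `β`. -/
lemma exists_tester_pair [Nonempty P] [∀ k, Nonempty (I k)] [∀ k, Nonempty (O k)] {n : ℕ}
    {C : Supermap P F I O n} (hC : IsVirtualComb n C) {β : ℝ}
    (hβ : ∀ v ∈ baseNormValues n C, β ≤ v) (hβ₀ : 0 ≤ β) :
    ∃ (T₁ T₂ : Matrix (Sys P I O n × F) (Sys P I O n × F) ℂ)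
      (Ξ : Matrix (Sys P I O n) (Sys P I O n) ℂ), T₁.PosSemidef ∧ T₂.PosSemidef ∧
      T₁ + T₂ = Ξ ⊗ₖ (1 : Matrix F F ℂ) ∧ IsTesterMarginal n Ξ ∧
      (choi n C * (T₁ - T₂)).trace.re = β := by
  have hcomb := hC.exists_isComb
  have hCs : choi n C ∈ combSpan n := ⟨1, hC.marginal⟩
  have hCh := hC.isHermitian_choi
  obtain ⟨d, hd, hdt⟩ := exists_trace_eq_mul (P := P) (I := I) (O := O) n
  have htr : ∀ {c : ℂ} {X : Matrix (Sys P I O n × F) (Sys P I O n × F) ℂ},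
      IsScaledCombMarginal n c (traceRight X) → X.trace.re = d * c.re := fun h => by
    rw [← trace_traceRight, hdt _ _ h, Complex.re_ofReal_mul]
  let W : Submodule ℝ (Matrix (Sys P I O n × F) (Sys P I O n × F) ℂ ×
      Matrix (Sys P I O n × F) (Sys P I O n × F) ℂ) :=
    { carrier := {Z | Z.1 + Z.2 ∈ combSpan n ∧ ∃ s : ℝ, Z.1 - Z.2 = (s : ℂ) • choi n C}
      add_mem' := by
        rintro Z Z' ⟨h₁, s, h₂⟩ ⟨h₁', s', h₂'⟩
        refine ⟨?_, s + s', ?_⟩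
        · rw [Prod.fst_add, Prod.snd_add, add_add_add_comm]
          exact (combSpan n).add_mem h₁ h₁'
        · rw [Prod.fst_add, Prod.snd_add, add_sub_add_comm, h₂, h₂', Complex.ofReal_add, add_smul]
      zero_mem' := by
        refine ⟨?_, 0, ?_⟩
        · simp
        · simp
      smul_mem' := by
        rintro t Z ⟨h₁, s, h₂⟩
        refine ⟨?_, t * s, ?_⟩
        · rw [Prod.smul_fst, Prod.smul_snd, ← smul_add, ← Complex.coe_smul]
          exact (combSpan n).smul_mem _ h₁
        · rw [Prod.smul_fst, Prod.smul_snd, ← smul_sub, h₂, ← Complex.coe_smul, smul_smul,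
            Complex.ofReal_mul] }
  let τ : Matrix (Sys P I O n × F) (Sys P I O n × F) ℂ →ₗ[ℝ] ℝ :=
    Complex.reLm ∘ₗ Matrix.traceLinearMap _ ℝ ℂ
  have hτ : ∀ X, τ X = X.trace.re := fun _ => rfl
  let φ : Matrix (Sys P I O n × F) (Sys P I O n × F) ℂ ×
      Matrix (Sys P I O n × F) (Sys P I O n × F) ℂ →ₗ[ℝ] ℝ :=
    (2 * d)⁻¹ • (τ ∘ₗ (LinearMap.fst ℝ _ _ + LinearMap.snd ℝ _ _) +
      β • τ ∘ₗ (LinearMap.fst ℝ _ _ - LinearMap.snd ℝ _ _))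
  have hφ : ∀ X Y, φ (X, Y) =
      (2 * d)⁻¹ * ((X.trace.re + Y.trace.re) + β * (X.trace.re - Y.trace.re)) := by
    intro X Y
    simp only [φ, hτ, LinearMap.smul_apply, LinearMap.add_apply, LinearMap.sub_apply,
      LinearMap.comp_apply, LinearMap.fst_apply, LinearMap.snd_apply, smul_eq_mul,
      Matrix.trace_add, Matrix.trace_sub, Complex.add_re, Complex.sub_re]
  obtain ⟨T₁, T₂, hT₁, hT₂, hT⟩ := exists_posSemidef_pair W φ
    ⟨(combSpan n).add_mem (one_mem_combSpan n) (one_mem_combSpan n), 0, by simp⟩ (by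
    rintro X Y ⟨⟨c, hc⟩, s, hs⟩ hX hY
    change IsScaledCombMarginal n c (traceRight (X + Y)) at hc
    change X - Y = (s : ℂ) • choi n C at hs
    set H := X + Xᴴ with hH
    set G := Y + Yᴴ with hG
    have hsub : H - G = ((2 * s : ℝ) : ℂ) • choi n C := by
      have : H - G = (X - Y) + (X - Y)ᴴ := by
        rw [Matrix.conjTranspose_sub, hH, hG]; abel
      rw [this, hs, Matrix.conjTranspose_smul, hCh.eq]
      simp only [Complex.star_def, Complex.conj_ofReal]
      push_cast
      module
    have hadd : H + G ∈ combSpan n := by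
      refine ⟨c + star c, ?_⟩
      have : H + G = (X + Y) + (X + Y)ᴴ := by
        rw [Matrix.conjTranspose_add, hH, hG]; abel
      rw [this, traceRight_add, traceRight_conjTranspose]
      exact hc.add hc.conjTranspose
    have hHm : H ∈ combSpan n := by
      have : H = (2⁻¹ : ℂ) • ((H + G) + (H - G)) := by module
      rw [this, hsub]
      exact (combSpan n).smul_mem _ ((combSpan n).add_mem hadd ((combSpan n).smul_mem _ hCs))
    have hGm : G ∈ combSpan n := by
      have : G = (2⁻¹ : ℂ) • ((H + G) - (H - G)) := by module
      rw [this, hsub]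
      exact (combSpan n).smul_mem _ ((combSpan n).sub_mem hadd ((combSpan n).smul_mem _ hCs))
    obtain ⟨p, hp⟩ := hHm
    obtain ⟨q, hq⟩ := hGm
    obtain ⟨p, hp₀, rfl⟩ := hp.exists_eq_ofReal hX
    obtain ⟨q, hq₀, rfl⟩ := hq.exists_eq_ofReal hY
    have hXt : 2 * X.trace.re = d * p := by
      have := htr hp
      rw [hH, Matrix.trace_add, Matrix.trace_conjTranspose] at this
      simp only [Complex.add_re, Complex.star_def, Complex.conj_re, Complex.ofReal_re] at this
      linarith
    have hYt : 2 * Y.trace.re = d * q := by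
      have := htr hq
      rw [hG, Matrix.trace_add, Matrix.trace_conjTranspose] at this
      simp only [Complex.add_re, Complex.star_def, Complex.conj_re, Complex.ofReal_re] at this
      linarith
    have hpq : p - q = 2 * s := by
      have := congrArg (fun Z => (Matrix.trace Z).re) hsub
      simp only [Matrix.trace_sub, Matrix.trace_smul, Complex.sub_re, smul_eq_mul,
        Complex.re_ofReal_mul, htr hp, htr hq, htr hC.marginal, Complex.ofReal_re,
        Complex.one_re] at this
      exact mul_left_cancel₀ hd.ne' (by linarith)
    have key : 0 ≤ (p + q) + β * (p - q) := by
      rcases le_or_gt 0 s with hs₀ | hs₀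
      · rw [hpq]
        positivity
      -- `𝖢 = t (G - H)` with `t = 1 / (-2 s) > 0` is a decomposition of value `t (p + q)`
      · set t : ℝ := (-(2 * s))⁻¹ with ht
        have ht₀ : 0 < t := inv_pos.mpr (by linarith)
        have hts : t * (2 * s) = -1 := by
          rw [ht, inv_neg, neg_mul, inv_mul_cancel₀ (by linarith)]
        have hv : t * q + t * p ∈ baseNormValues n C := by
          refine (mem_baseNormValues_iff hcomb).mpr ⟨(t : ℂ) • G, (t : ℂ) • H, t * q, t * p,
            hY.smul (Complex.zero_le_real.mpr ht₀.le), hX.smul (Complex.zero_le_real.mpr ht₀.le),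
            ?_, ?_, ?_, rfl⟩
          · rw [traceRight_smul, Complex.ofReal_mul]
            exact hq.smul _
          · rw [traceRight_smul, Complex.ofReal_mul]
            exact hp.smul _
          · rw [← smul_sub, ← neg_sub H G, hsub, smul_neg, smul_smul, ← Complex.ofReal_mul, hts]
            simp
        have h₁ := mul_le_mul_of_nonneg_right (hβ _ hv) (show 0 ≤ -(2 * s) by linarith)
        have h₂ : (t * q + t * p) * -(2 * s) = p + q := by
          linear_combination (-(q + p)) * hts
        rw [h₂] at h₁
        rw [hpq]
        linarith
    rw [hφ]
    have hXY : (X.trace.re + Y.trace.re) + β * (X.trace.re - Y.trace.re) =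
        d / 2 * ((p + q) + β * (p - q)) := by
      linear_combination (1 + β) / 2 * hXt + (1 - β) / 2 * hYt
    rw [hXY]
    positivity)
  have hre : ∀ (c : ℂ) (D : Matrix (Sys P I O n × F) (Sys P I O n × F) ℂ),
      IsScaledCombMarginal n c (traceRight D) → ((T₁ + T₂) * D).trace.re = c.re := by
    intro c D hD
    have hDs : D ∈ combSpan n := ⟨c, hD⟩
    have := hT D D ⟨(combSpan n).add_mem hDs hDs, 0, by simp⟩
    rw [hφ, htr hD] at this
    rw [add_mul, Matrix.trace_add, Complex.add_re, ← this]
    field_simp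
    ring
  have hsum : ∀ (c : ℂ) (D : Matrix (Sys P I O n × F) (Sys P I O n × F) ℂ),
      IsScaledCombMarginal n c (traceRight D) → ((T₁ + T₂) * D).trace = c := by
    intro c D hD
    refine Complex.ext (hre c D hD) ?_
    have := hre (Complex.I * c) (Complex.I • D) (by
      rw [traceRight_smul]; exact hD.smul _)
    rw [Matrix.mul_smul, Matrix.trace_smul, smul_eq_mul, Complex.I_mul_re, Complex.I_mul_re]
      at this
    exact neg_injective this
  obtain ⟨Ξ, hΞ, hΞm⟩ := exists_isTesterMarginal_of_trace_mul hsum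
  refine ⟨T₁, T₂, Ξ, hT₁, hT₂, hΞ, hΞm, ?_⟩
  have := hT (choi n C) (-choi n C) ⟨by simp, 2, by
    simp only [sub_neg_eq_add]
    push_cast
    module⟩
  rw [hφ, Matrix.trace_neg, Complex.neg_re, htr hC.marginal, mul_neg, Matrix.trace_neg,
    Complex.neg_re, Complex.one_re] at this
  rw [mul_sub, Matrix.trace_sub, Complex.sub_re, Matrix.trace_mul_comm _ T₁,
    Matrix.trace_mul_comm _ T₂]
  have e : (2 * d)⁻¹ * (d * 1 + -(d * 1) + β * (d * 1 - -(d * 1))) = β := by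
    field_simp
    ring
  linarith

end testers

end duality

end QComb

theorem lemma1 {P F : Type u} {I O : ℕ → Type u}
    [Fintype P] [DecidableEq P] [Nonempty P] [Fintype F] [DecidableEq F] [Nonempty F]
    [∀ k, Fintype (I k)] [∀ k, DecidableEq (I k)] [∀ k, Nonempty (I k)]
    [∀ k, Fintype (O k)] [∀ k, DecidableEq (O k)] [∀ k, Nonempty (O k)]
    (n : ℕ) (C : QComb.Supermap P F I O n) (hC : QComb.IsVirtualComb n C) :
    IsLeast (QComb.baseNormValues n C) (QComb.baseNorm n C) ∧
    IsGreatest (QComb.diamondNormValues n C) (QComb.diamondNorm n C) ∧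
    QComb.baseNorm n C = QComb.diamondNorm n C := by
  obtain ⟨β, hβ⟩ := QComb.exists_isLeast_baseNormValues hC
  have hβ₀ : 0 ≤ β := by
    obtain ⟨r, s, -, -, hr, hs, -, -, -, h⟩ := hβ.1
    rw [h]
    exact add_nonneg hr hs
  obtain ⟨T₁, T₂, Ξ, hT₁, hT₂, hΞ, hΞm, hval⟩ := QComb.exists_tester_pair hC hβ.2 hβ₀
  have hT : QComb.IsTester n ![T₁, T₂] Ξ := by
    refine ⟨fun i => ?_, ?_, hΞm⟩
    · fin_cases i
      · exact hT₁
      · exact hT₂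
    · simpa [Fin.sum_univ_two] using hΞ
  have hmem : QComb.traceNorm ((CFC.sqrt Ξ ⊗ₖ (1 : Matrix F F ℂ)) * QComb.choi n C *
      (CFC.sqrt Ξ ⊗ₖ (1 : Matrix F F ℂ))) ∈ QComb.diamondNormValues n C :=
    ⟨2, _, Ξ, hT, rfl⟩
  have hle := QComb.re_trace_mul_le_traceNorm_conj (T := T₁ - T₂)
    (QComb.posSemidef_sqrt_kronecker_one (b := F) Ξ) hC.isHermitian_choi
    (by
      rw [QComb.sqrt_kronecker_one_mul_self hT.posSemidef_marginal, ← hΞ]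
      convert hT₂.add hT₂ using 1
      abel)
    (by
      rw [QComb.sqrt_kronecker_one_mul_self hT.posSemidef_marginal, ← hΞ]
      convert hT₁.add hT₁ using 1
      abel)
  have heq := le_antisymm (QComb.diamond_le_base hC hβ.1 hmem) (hval ▸ hle)
  have hgr : IsGreatest (QComb.diamondNormValues n C) β :=
    ⟨heq ▸ hmem, fun w hw => QComb.diamond_le_base hC hβ.1 hw⟩
  have e₁ : QComb.baseNorm n C = β := hβ.csInf_eq
  have e₂ : QComb.diamondNorm n C = β := hgr.csSup_eq
  rw [e₁, e₂]
  exact ⟨hβ, hgr, rfl⟩
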